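/- Let $E$ be a (real) Banach lattice and let $p \ge 1$ be a real number. A sequence $(x_n)_n$ in $E$ is called disjoint if $|x_m| \wedge |x_n| = 0$ whenever $m \neq n$, and weakly $p$-summable if $\sum_n |x^*(x_n)|^p < \infty$ for every $x^*$ in the topological dual $E^*$. Then the following are equivalent: (1) $E$ has the positive Schur property of order $p$ ($SP_p^+$), that is, every disjoint weakly $p$-summable sequence in $E$ converges to $0$ in norm. (2) $E$ has order continuous norm (that is, $\inf\{\|x\| : x \in A\} = 0$ for every nonempty downwards directed set $A \subseteq E$ with $\inf A = 0$) and $E$ has the disjoint Dunford-Pettis$^*$ property of order $p$ (disjoint $DP^*P_p$), that is, for every disjoint weakly $p$-summable sequence $(x_n)_n$ in $E$ the set $\{x_n : n \in \mathbb{N}\}$ is limited, which means that every weak$^*$ null sequence $(x_k^*)_k$ in $E^*$ satisfies $\sup_{n} |x_k^*(x_n)| \to 0$ as $k \to \infty$. -/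

import Mathlib

open Filter Topology

/-- A sequence in a lattice-ordered group is disjoint if its terms with distinct indices are
disjoint: `|x m| ⊓ |x n| = 0` for `m ≠ n`. -/
def IsDisjointSeq {E : Type*} [AddCommGroup E] [Lattice E] (x : ℕ → E) : Prop :=
  Pairwise fun m n => |x m| ⊓ |x n| = 0

/-- A sequence in a normed space is weakly `p`-summable if `∑ |f (x n)| ^ p < ∞` for every
bounded linear functional `f`. -/
def IsWeaklyPSummable {E : Type*} [NormedAddCommGroup E] [NormedSpace ℝ E]
    (p : ℝ) (x : ℕ → E) : Prop :=
  ∀ f : StrongDual ℝ E, Summable fun n => |f (x n)| ^ p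

/-- A set is limited if every weak* null sequence in the dual converges to zero uniformly
on it. -/
def IsLimitedSet {E : Type*} [NormedAddCommGroup E] [NormedSpace ℝ E] (A : Set E) : Prop :=
  ∀ f : ℕ → WeakDual ℝ E, Tendsto f atTop (𝓝 0) →
    TendstoUniformlyOn (fun n x => f n x) (fun _ => (0 : ℝ)) atTop A

/-- The norm is order continuous if `inf {‖x‖ : x ∈ A} = 0` for every nonempty
downwards directed set `A` with infimum `0`. -/
def HasOrderContinuousNorm (E : Type*) [NormedAddCommGroup E] [Lattice E] : Prop :=
  ∀ A : Set E, A.Nonempty → DirectedOn (fun a b => b ≤ a) A → IsGLB A 0 →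
    IsGLB ((fun x => ‖x‖) '' A) (0 : ℝ)

/-- The positive Schur property of order `p`: disjoint weakly `p`-summable sequences are norm
null, that is, the identity operator is disjoint `p`-convergent. -/
def HasPositiveSchurProperty (p : ℝ) (E : Type*) [NormedAddCommGroup E] [NormedSpace ℝ E]
    [Lattice E] : Prop :=
  ∀ x : ℕ → E, IsDisjointSeq x → IsWeaklyPSummable p x → Tendsto x atTop (𝓝 0)

/-- The disjoint Dunford-Pettis* property of order `p`: the set of terms of every disjoint
weakly `p`-summable sequence is limited. -/
def HasDisjointDPStarProperty (p : ℝ) (E : Type*) [NormedAddCommGroup E] [NormedSpace ℝ E]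
    [Lattice E] : Prop :=
  ∀ x : ℕ → E, IsDisjointSeq x → IsWeaklyPSummable p x → IsLimitedSet (Set.range x)

/-! Both directions pass through `OrderBoundedDisjointSeqNull`, which in a Banach lattice is
equivalent to order continuity of the norm. An order bounded disjoint positive sequence is weakly
absolutely summable, hence weakly `p`-summable as `1 ≤ p`, so the Schur property yields this
condition; Banach-Steinhaus makes the range of a norm null sequence limited. Conversely, Hahn-Banach
gives functionals `f n` norming `x n` and dominated by `bandNorm |x n|`. Disjointness and order
continuity make them weak* null, and limitedness forces `f n (x n) = ‖x n‖` to tend to zero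
(`IsDisjointSeq.tendsto_zero_of_isLimitedSet_range`). -/

/-! ### Inequalities in lattice-ordered groups. -/

section LatticeGroup

variable {E : Type*} [AddCommGroup E] [Lattice E]

theorem inf_eq_zero_of_le {a b c d : E} (hc : 0 ≤ c) (hd : 0 ≤ d) (hca : c ≤ a)
    (hdb : d ≤ b) (h : a ⊓ b = 0) : c ⊓ d = 0 :=
  le_antisymm (h ▸ inf_le_inf hca hdb) (le_inf hc hd)

variable [IsOrderedAddMonoid E]

theorem inf_add_le_inf_add_inf {a b c : E} (ha : 0 ≤ a) (hb : 0 ≤ b) (hc : 0 ≤ c) :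
    a ⊓ (b + c) ≤ a ⊓ b + a ⊓ c := by
  rw [inf_add]
  refine le_inf (inf_le_left.trans (le_add_of_nonneg_right (le_inf ha hc))) ?_
  rw [add_inf]
  exact le_inf (inf_le_left.trans (le_add_of_nonneg_left hb)) inf_le_right

theorem inf_sum_le_sum_inf {ι : Type*} {a : E} (ha : 0 ≤ a) {v : ι → E} (hv : ∀ i, 0 ≤ v i)
    (s : Finset ι) : a ⊓ ∑ i ∈ s, v i ≤ ∑ i ∈ s, a ⊓ v i := by
  classical
  induction s using Finset.induction_on with
  | empty => simp
  | insert i s hi ih =>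
    rw [Finset.sum_insert hi, Finset.sum_insert hi]
    refine (inf_add_le_inf_add_inf ha (hv i) (Finset.sum_nonneg fun j _ => hv j)).trans ?_
    gcongr

/-- For disjoint elements the sum is the supremum. -/
theorem sum_le_of_pairwise_inf_eq_zero {ι : Type*} {w : ι → E} (hw : ∀ i, 0 ≤ w i)
    (hd : Pairwise fun i j => w i ⊓ w j = 0) {z : E} (hz : 0 ≤ z) (hwz : ∀ i, w i ≤ z)
    (s : Finset ι) : ∑ i ∈ s, w i ≤ z := by
  classical
  induction s using Finset.induction_on with
  | empty => simpa
  | insert i s hi ih =>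
    have h0 : w i ⊓ ∑ j ∈ s, w j = 0 := by
      refine le_antisymm ((inf_sum_le_sum_inf (hw i) hw s).trans ?_)
        (le_inf (hw i) (Finset.sum_nonneg fun j _ => hw j))
      refine (Finset.sum_eq_zero fun j hj => hd ?_).le
      rintro rfl
      exact hi hj
    rw [Finset.sum_insert hi, ← inf_add_sup, h0, zero_add]
    exact sup_le (hwz i) ih

theorem posPart_inf_posPart (a b : E) : a⁺ ⊓ b⁺ = (a ⊓ b)⁺ := by
  let := AddCommGroup.toDistribLattice E
  exact (sup_inf_right a b (0 : E)).symm

theorem le_posPart_sub_add_inf_add {a b c : E} (hc : 0 ≤ c) :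
    a ≤ (a - b - c)⁺ + a ⊓ b + c := by
  have h : (a - b)⁺ ≤ (a - b - c)⁺ + c :=
    sup_le (sub_le_iff_le_add.1 (le_posPart _)) (add_nonneg (posPart_nonneg _) hc)
  rw [inf_eq_sub_posPart_sub]
  calc a = (a - b)⁺ + (a - (a - b)⁺) := by abel
    _ ≤ ((a - b - c)⁺ + c) + (a - (a - b)⁺) := by gcongr
    _ = _ := by abel

end LatticeGroup

/-! ### Scalar multiples and disjointification. -/

section VectorLattice

variable {E : Type*} [AddCommGroup E] [Module ℝ E] [Lattice E] [IsOrderedModule ℝ E]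

theorem smul_sup_of_nonneg {c : ℝ} (hc : 0 ≤ c) (a b : E) : c • (a ⊔ b) = c • a ⊔ c • b := by
  rcases hc.eq_or_lt with rfl | hc
  · simp
  · exact (OrderIso.smulRight (β := E) hc).map_sup a b

theorem smul_inf_of_nonneg {c : ℝ} (hc : 0 ≤ c) (a b : E) : c • (a ⊓ b) = c • a ⊓ c • b := by
  rcases hc.eq_or_lt with rfl | hc
  · simp
  · exact (OrderIso.smulRight (β := E) hc).map_inf a b

theorem abs_smul_of_nonneg {c : ℝ} (hc : 0 ≤ c) (a : E) : |c • a| = c • |a| := by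
  simp only [abs, smul_sup_of_nonneg hc, smul_neg]

variable [IsOrderedAddMonoid E]

theorem le_smul_of_one_le {c : ℝ} (hc : 1 ≤ c) {a : E} (ha : 0 ≤ a) : a ≤ c • a := by
  simpa using smul_le_smul_of_nonneg_right hc ha

theorem inf_smul_le_smul_inf {c : ℝ} (hc : 1 ≤ c) {a : E} (ha : 0 ≤ a) (b : E) :
    a ⊓ c • b ≤ c • (a ⊓ b) := by
  rw [smul_inf_of_nonneg (zero_le_one.trans hc)]
  exact inf_le_inf_right _ (le_smul_of_one_le hc ha)

/-- Since `c • (a - w) ≤ c • a - b`, the second factor lies below the negative part of `b - c • a`.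
-/
theorem posPart_sub_smul_inf_posPart_sub_eq_zero {c : ℝ} (hc : 1 ≤ c) {a b w : E}
    (hb : b ≤ c • w) : (b - c • a)⁺ ⊓ (a - w)⁺ = 0 := by
  have h0 : (0 : ℝ) ≤ c := zero_le_one.trans hc
  refine inf_eq_zero_of_le (posPart_nonneg _) (posPart_nonneg _) le_rfl ?_
    (posPart_inf_negPart_eq_zero (b - c • a))
  refine (le_smul_of_one_le hc (posPart_nonneg _)).trans ?_
  rw [posPart_def, smul_sup_of_nonneg h0, smul_zero, smul_sub, negPart_def, neg_sub]
  gcongr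

end VectorLattice

/-! ### From disjoint sequences to positive series with bounded partial sums. -/

section NormedLattice

theorem frequently_le_norm_of_not_tendsto_zero {E : Type*} [NormedAddCommGroup E] {v : ℕ → E} 
    (h : ¬ Tendsto v atTop (𝓝 0)) :
    ∃ ε > 0, ∃ᶠ n in atTop, ε ≤ ‖v n‖ := by
  rw [Metric.tendsto_nhds] at h
  push Not at h
  simpa only [dist_zero_right, Filter.not_eventually, not_lt, gt_iff_lt] using h

variable {E : Type*} [NormedAddCommGroup E] [Lattice E] [IsOrderedAddMonoid E] [HasSolidNorm E]

theorem norm_le_norm_of_nonneg_of_le {a b : E} (ha : 0 ≤ a) (hab : a ≤ b) : ‖a‖ ≤ ‖b‖ :=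
  norm_le_norm_of_abs_le_abs (by rwa [abs_of_nonneg ha, abs_of_nonneg (ha.trans hab)])

theorem norm_inf_le_norm_of_nonneg {u : E} (hu : 0 ≤ u) (y : E) : ‖|y| ⊓ u‖ ≤ ‖y‖ := by
  rw [← norm_abs_eq_norm y]
  exact norm_le_norm_of_nonneg_of_le (le_inf (abs_nonneg y) hu) inf_le_left

/-- Order bounded disjoint sequences of positive elements are norm null. -/
def OrderBoundedDisjointSeqNull (E : Type*) [NormedAddCommGroup E] [Lattice E] : Prop :=
  ∀ (w : ℕ → E) (x : E), (∀ n, 0 ≤ w n) → (∀ n, w n ≤ x) →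
    (Pairwise fun m n => w m ⊓ w n = 0) → Tendsto w atTop (𝓝 0)

variable [NormedSpace ℝ E] [IsOrderedModule ℝ E]

/-- Along a sparse subsequence of norm at least `ε`, subtracting `M` times the earlier terms and `w
= x / M` leaves a truly disjoint sequence of positive parts. The two corrections cost at most `ε /
4` each, so a null sequence of positive parts is a contradiction. -/
theorem OrderBoundedDisjointSeqNull.tendsto_zero_of_inf (hE : OrderBoundedDisjointSeqNull E)
    {v : ℕ → E} {x : E} (hv : ∀ n, 0 ≤ v n) (hvx : ∀ n, v n ≤ x)
    (h : ∀ m, Tendsto (fun n => v n ⊓ v m) atTop (𝓝 0)) : Tendsto v atTop (𝓝 0) := by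
  by_contra hcon
  obtain ⟨ε, hε, hfr⟩ := frequently_le_norm_of_not_tendsto_zero hcon
  have hx : 0 ≤ x := (hv 0).trans (hvx 0)
  obtain ⟨M, hM1, hMx⟩ : ∃ M : ℝ, 1 ≤ M ∧ M⁻¹ * ‖x‖ ≤ ε / 4 := by
    refine ⟨max 1 (4 * ‖x‖ / ε), le_max_left _ _, ?_⟩
    have hpos : 0 < max 1 (4 * ‖x‖ / ε) := lt_max_of_lt_left one_pos
    rw [inv_mul_le_iff₀ hpos]
    have := le_max_right 1 (4 * ‖x‖ / ε)
    rw [div_le_iff₀ hε] at this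
    linarith
  have hM0 : 0 < M := one_pos.trans_le hM1
  set w : E := M⁻¹ • x with hw
  have hw0 : 0 ≤ w := smul_nonneg (by positivity) hx
  have hMw : M • w = x := by rw [hw, smul_smul, mul_inv_cancel₀ hM0.ne', one_smul]
  have hwn : ‖w‖ ≤ ε / 4 := by
    rw [hw, norm_smul, Real.norm_of_nonneg (by positivity)]; exact hMx
  -- The geometric weights sum to at most `2`, so after the factor `M` the overlaps total at most `ε
  -- / 4`.
  obtain ⟨f, hfP, hfr⟩ := exists_seq_of_forall_finset_exists (fun n => ε ≤ ‖v n‖)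
    (fun m n => m < n ∧ ‖v n ⊓ v m‖ ≤ ε / (8 * M) * (1 / 2) ^ m) (by
      intro s _
      have h1 : ∀ᶠ n in atTop, ∀ m ∈ s, m < n ∧ ‖v n ⊓ v m‖ ≤ ε / (8 * M) * (1 / 2) ^ m := by
        rw [Filter.eventually_all_finset]
        intro m _
        have h2 := (h m).norm
        rw [norm_zero] at h2
        exact (eventually_gt_atTop m).and (h2.eventually_le_const (by positivity))
      exact (hfr.and_eventually h1).exists)
  have hmono : StrictMono f := strictMono_nat_of_lt_succ fun n => (hfr n (n + 1) (by lia)).1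
  set u : ℕ → E := fun n => v (f n) with hu
  set S : ℕ → E := fun k => ∑ i ∈ Finset.range k, u i with hS
  have hS0 : ∀ k, 0 ≤ S k := fun k => Finset.sum_nonneg fun i _ => hv _
  have hSn : ∀ k, ‖u k ⊓ M • S k‖ ≤ ε / 4 := by
    intro k
    have h1 : u k ⊓ M • S k ≤ M • ∑ i ∈ Finset.range k, u k ⊓ u i :=
      (inf_smul_le_smul_inf hM1 (hv _) _).trans
        (smul_le_smul_of_nonneg_left (inf_sum_le_sum_inf (hv _) (fun i => hv (f i)) _) hM0.le)
    have h2 : ∀ i ∈ Finset.range k, ‖u k ⊓ u i‖ ≤ ε / (8 * M) * (1 / 2) ^ i := by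
      intro i hi
      refine (hfr i k (Finset.mem_range.1 hi)).2.trans ?_
      gcongr ?_ * ?_
      exact pow_le_pow_of_le_one (by norm_num) (by norm_num) (hmono.le_apply)
    calc ‖u k ⊓ M • S k‖ ≤ ‖M • ∑ i ∈ Finset.range k, u k ⊓ u i‖ :=
          norm_le_norm_of_nonneg_of_le (le_inf (hv _) (smul_nonneg hM0.le (hS0 k))) h1
      _ = M * ‖∑ i ∈ Finset.range k, u k ⊓ u i‖ := by
          rw [norm_smul, Real.norm_of_nonneg hM0.le]
      _ ≤ M * ∑ i ∈ Finset.range k, ε / (8 * M) * (1 / 2) ^ i := by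
          gcongr; exact norm_sum_le_of_le _ h2
      _ ≤ M * (ε / (8 * M) * 2) := by
          rw [← Finset.mul_sum]; gcongr; exact sum_geometric_two_le k
      _ = ε / 4 := by field_simp; norm_num
  set z : ℕ → E := fun k => (u k - M • S k - w)⁺ with hz
  have hlt : ∀ i k, i < k → z k ⊓ z i = 0 := by
    intro i k hik
    refine inf_eq_zero_of_le (posPart_nonneg _) (posPart_nonneg _) ?_ ?_
      (posPart_sub_smul_inf_posPart_sub_eq_zero hM1 (a := u i) (b := u k) (w := w)
        (hMw ▸ hvx _))
    · refine posPart_mono ?_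
      rw [sub_sub]
      refine sub_le_sub_left (le_add_of_le_of_nonneg (smul_le_smul_of_nonneg_left ?_ hM0.le) hw0) _
      exact Finset.single_le_sum (f := u) (fun j _ => hv _) (Finset.mem_range.2 hik)
    · exact posPart_mono (sub_le_sub_right (sub_le_self _ (smul_nonneg hM0.le (hS0 i))) _)
  have hz0 : Tendsto z atTop (𝓝 0) := by
    refine hE z x (fun _ => posPart_nonneg _) (fun k => sup_le ?_ hx) ?_
    · rw [sub_sub]
      exact (sub_le_self _ (add_nonneg (smul_nonneg hM0.le (hS0 k)) hw0)).trans (hvx _)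
    · intro m n hmn
      rcases lt_or_gt_of_ne hmn with h | h
      · rw [inf_comm]; exact hlt _ _ h
      · exact hlt _ _ h
  have hz1 := hz0.norm
  rw [norm_zero] at hz1
  obtain ⟨k, hk⟩ := (hz1.eventually_lt_const (show 0 < ε / 4 by positivity)).exists
  have hle : ‖u k‖ ≤ ‖z k + u k ⊓ M • S k + w‖ :=
    norm_le_norm_of_nonneg_of_le (hv _) (le_posPart_sub_add_inf_add hw0)
  have h3 : ‖z k + u k ⊓ M • S k + w‖ ≤ ‖z k‖ + ‖u k ⊓ M • S k‖ + ‖w‖ := norm_add₃_le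
  have := hSn k
  have := hfP k
  change ε ≤ ‖u k‖ at this
  linarith

/-- By `tendsto_zero_of_inf` only infima with a fixed `m`-th term matter. These have the same form
with `b ⊓ (y m - w)` for `b`: one more copy of `b` is charged and one copy of `w` is spent. With no
`w` left, `b ≤ 0`. -/
theorem OrderBoundedDisjointSeqNull.tendsto_posPart_inf_sub (hE : OrderBoundedDisjointSeqNull E)
    {x w : E} (j : ℕ) : ∀ (k : ℕ) (b : E) (y : ℕ → E), 0 < k + j → (∀ n, 0 ≤ y n) →
      (∀ n, y n ≤ x) → 0 ≤ w → (∀ s : Finset ℕ, k • b + ∑ i ∈ s, y i ≤ j • w) →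
      Tendsto (fun n => (b ⊓ (y n - w))⁺) atTop (𝓝 0) := by
  induction j with
  | zero =>
    intro k b y hk _ _ _ hs
    have hb : b ≤ 0 := by
      have h1 : k • b ≤ 0 := by simpa using hs ∅
      have h2 : (k : ℝ) • b ≤ (k : ℝ) • (0 : E) := by rwa [Nat.cast_smul_eq_nsmul, smul_zero]
      exact le_of_smul_le_smul_left h2 (by exact_mod_cast hk)
    have : ∀ n, (b ⊓ (y n - w))⁺ = 0 := fun n => posPart_eq_zero.2 (inf_le_left.trans hb)
    simp [this]
  | succ j ih =>
    intro k b y _ hy hyx hw hs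
    refine hE.tendsto_zero_of_inf (x := x) (fun _ => posPart_nonneg _)
      (fun n => sup_le (inf_le_right.trans ((sub_le_self _ hw).trans (hyx n)))
        ((hy n).trans (hyx n))) fun m => ?_
    -- Only indices beyond `m` are kept, so that `y m` is not counted twice.
    rw [← tendsto_add_atTop_iff_nat (m + 1)]
    refine (ih (k + 1) (b ⊓ (y m - w)) (fun n => y (n + (m + 1))) (by lia) (fun _ => hy _)
      (fun _ => hyx _) hw ?_).congr fun n => ?_
    · intro s
      have h1 := hs (insert m (s.map (addRightEmbedding (m + 1))))
      rw [Finset.sum_insert (by simp; lia), Finset.sum_map] at h1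
      simp only [addRightEmbedding_apply] at h1
      have h2 : (k + 1) • (b ⊓ (y m - w)) ≤ k • b + (y m - w) := by
        rw [succ_nsmul]
        exact add_le_add (nsmul_le_nsmul_right inf_le_left k) inf_le_right
      calc _ ≤ k • b + (y m - w) + ∑ i ∈ s, y (i + (m + 1)) := by gcongr
        _ = k • b + (y m + ∑ i ∈ s, y (i + (m + 1))) - w := by abel
        _ ≤ (j + 1) • w - w := by gcongr
        _ = j • w := by rw [succ_nsmul]; abel
    · rw [posPart_inf_posPart]
      congr 1
      apply le_antisymm
      · exact le_inf (le_inf (inf_le_left.trans inf_le_left) inf_le_right) inf_le_left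
      · exact le_inf inf_le_right (inf_le_left.trans inf_le_right)

/-- If order bounded disjoint sequences are norm null, then the terms of a positive series with
order bounded partial sums are norm null. -/
theorem OrderBoundedDisjointSeqNull.tendsto_zero_of_sum_le (hE : OrderBoundedDisjointSeqNull E)
    {x : E} {y : ℕ → E} (hy : ∀ n, 0 ≤ y n) (hs : ∀ s : Finset ℕ, ∑ i ∈ s, y i ≤ x) :
    Tendsto y atTop (𝓝 0) := by
  have hx : 0 ≤ x := by simpa using hs ∅
  have hyx : ∀ n, y n ≤ x := fun n => by simpa using hs {n}
  rw [tendsto_zero_iff_norm_tendsto_zero, Metric.tendsto_nhds]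
  intro ε hε
  obtain ⟨N, hN⟩ := exists_nat_gt (2 * ‖x‖ / ε)
  have hN0 : (0 : ℝ) < N := lt_of_le_of_lt (by positivity) hN
  set w : E := (N : ℝ)⁻¹ • x with hw
  have hw0 : 0 ≤ w := smul_nonneg (by positivity) hx
  have hNw : N • w = x := by
    rw [← Nat.cast_smul_eq_nsmul ℝ, hw, smul_smul, mul_inv_cancel₀ hN0.ne', one_smul]
  have hwn : ‖w‖ < ε / 2 := by
    rw [hw, norm_smul, Real.norm_of_nonneg (by positivity), inv_mul_lt_iff₀ hN0]
    rw [div_lt_iff₀ hε] at hN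
    linarith
  -- With `b = x` the infimum is just `y n - w`, and `N • w = x` is the required bound.
  have h := (hE.tendsto_posPart_inf_sub (x := x) (w := w) N 0 x y
    (by simpa using (by exact_mod_cast hN0 : 0 < N)) hy hyx hw0 (by simpa [hNw] using hs)).norm
  rw [norm_zero] at h
  filter_upwards [h.eventually_lt_const (half_pos hε)] with n hn
  have hinf : x ⊓ (y n - w) = y n - w := inf_eq_right.2 ((sub_le_self _ hw0).trans (hyx n))
  rw [hinf] at hn
  have h1 : ‖y n‖ ≤ ‖(y n - w)⁺ + w‖ :=
    norm_le_norm_of_nonneg_of_le (hy n) (sub_le_iff_le_add.1 (le_posPart _))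
  have h2 := norm_add_le ((y n - w)⁺) w
  rw [dist_zero_right, norm_norm]
  linarith

end NormedLattice

/-! ### Order continuity in terms of disjoint sequences. -/

section OrderContinuity

variable {E : Type*} [NormedAddCommGroup E] [NormedSpace ℝ E] [Lattice E] [IsOrderedAddMonoid E]
  [HasSolidNorm E]

theorem nonpos_of_forall_nsmul_le {b z : E} (h : ∀ n : ℕ, n • b⁺ ≤ z) : b ≤ 0 := by
  have hb : ∀ n : ℕ, n * ‖b⁺‖ ≤ ‖z‖ := fun n => by
    rw [← nsmul_eq_mul, ← RCLike.norm_nsmul ℝ]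
    exact norm_le_norm_of_nonneg_of_le (nsmul_nonneg (posPart_nonneg b) n) (h n)
  have h0 : ‖b⁺‖ = 0 := by
    by_contra hne
    have hpos : 0 < ‖b⁺‖ := lt_of_le_of_ne (norm_nonneg _) (Ne.symm hne)
    obtain ⟨n, hn⟩ := exists_nat_gt (‖z‖ / ‖b⁺‖)
    rw [div_lt_iff₀ hpos] at hn
    exact hn.not_ge (hb n)
  exact posPart_eq_zero.1 (norm_eq_zero.1 h0)

theorem HasOrderContinuousNorm.orderBoundedDisjointSeqNull (hE : HasOrderContinuousNorm E) :
    OrderBoundedDisjointSeqNull E := by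
  intro w x hw hwx hd
  have hsum : ∀ z : E, (∀ n, w n ≤ z) → ∀ s : Finset ℕ, ∑ i ∈ s, w i ≤ z := fun z hz =>
    sum_le_of_pairwise_inf_eq_zero hw hd ((hw 0).trans (hz 0)) hz
  -- Each `z - ∑ i < n, w i` dominates every `w k` with `k ≥ n`, so small elements of `A` suffice.
  set A : Set E := {a | ∃ z : E, ∃ n : ℕ, (∀ k, w k ≤ z) ∧ a = z - ∑ i ∈ Finset.range n, w i}
    with hA
  have hAne : A.Nonempty := ⟨_, x, 0, hwx, rfl⟩
  have hmono : Monotone fun n => ∑ i ∈ Finset.range n, w i :=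
    monotone_nat_of_le_succ fun n => by
      rw [Finset.sum_range_succ]; exact le_add_of_nonneg_right (hw n)
  have hdir : DirectedOn (fun a b => b ≤ a) A := by
    rintro _ ⟨z, n, hz, rfl⟩ _ ⟨z', n', hz', rfl⟩
    refine ⟨_, ⟨z ⊓ z', max n n', fun k => le_inf (hz k) (hz' k), rfl⟩, ?_, ?_⟩
    · exact sub_le_sub inf_le_left (hmono (le_max_left _ _))
    · exact sub_le_sub inf_le_right (hmono (le_max_right _ _))
  have hglb : IsGLB A 0 := by
    have h0 : (0 : E) ∈ lowerBounds A := by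
      rintro _ ⟨z, n, hz, rfl⟩
      exact sub_nonneg.2 (hsum z hz _)
    refine ⟨h0, fun b hb => nonpos_of_forall_nsmul_le (z := x) fun n => ?_⟩
    -- Subtracting `b⁺` from an upper bound of the sequence leaves an upper bound.
    have key : ∀ n : ℕ, ∀ k, w k ≤ x - n • b⁺ := by
      intro n
      induction n with
      | zero => simpa using hwx
      | succ n ih =>
        intro k
        have hmem : (x - n • b⁺) - ∑ i ∈ Finset.range (k + 1), w i ∈ A := ⟨_, _, ih, rfl⟩
        have h1 : b⁺ ≤ (x - n • b⁺) - ∑ i ∈ Finset.range (k + 1), w i :=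
          sup_le (hb hmem) (h0 hmem)
        have h2 : w k ≤ ∑ i ∈ Finset.range (k + 1), w i :=
          Finset.single_le_sum (f := w) (fun i _ => hw i) (by simp)
        rw [succ_nsmul, ← sub_sub]
        exact h2.trans (le_sub_comm.1 h1)
    exact sub_nonneg.1 ((hw 0).trans (key n 0))
  have hn := hE A hAne hdir hglb
  rw [tendsto_zero_iff_norm_tendsto_zero, Metric.tendsto_nhds]
  intro ε hε
  obtain ⟨_, ⟨_, ⟨z, n, hz, rfl⟩, rfl⟩, _, hlt⟩ := hn.exists_between hε
  filter_upwards [eventually_ge_atTop n] with k hk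
  rw [dist_zero_right, norm_norm]
  refine lt_of_le_of_lt (norm_le_norm_of_nonneg_of_le (hw k) (le_sub_iff_add_le.2 ?_)) hlt
  calc w k + ∑ i ∈ Finset.range n, w i ≤ ∑ i ∈ Finset.range (k + 1), w i := by
        rw [Finset.sum_range_succ, add_comm]
        exact add_le_add_left (hmono hk) _
    _ ≤ z := hsum z hz _

variable [IsOrderedModule ℝ E]

/-- Otherwise some decreasing sequence in `A` has steps of norm at least `ε`, yet the steps
telescope below its first term. -/
theorem OrderBoundedDisjointSeqNull.exists_norm_sub_lt (hE : OrderBoundedDisjointSeqNull E)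
    {A : Set E} (hA : A.Nonempty) (hA0 : ∀ a ∈ A, 0 ≤ a) {ε : ℝ} (hε : 0 < ε) :
    ∃ a ∈ A, ∀ b ∈ A, b ≤ a → ‖a - b‖ < ε := by
  by_contra! hcon
  choose! g hgA hga hgε using hcon
  obtain ⟨a₀, ha₀⟩ := hA
  set a : ℕ → E := fun n => g^[n] a₀ with ha
  have hsucc : ∀ n, a (n + 1) = g (a n) := fun n => Function.iterate_succ_apply' g n a₀
  have haA : ∀ n, a n ∈ A := by
    intro n
    induction n with
    | zero => exact ha₀
    | succ n ih => rw [hsucc]; exact hgA _ ih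
  have hnull : Tendsto (fun n => a n - a (n + 1)) atTop (𝓝 0) := by
    have hpos : ∀ n, 0 ≤ a n - a (n + 1) := fun n => by
      rw [sub_nonneg, hsucc]; exact hga _ (haA n)
    refine hE.tendsto_zero_of_sum_le (x := a 0) hpos fun s => ?_
    obtain ⟨N, hN⟩ := s.exists_nat_subset_range
    refine (Finset.sum_le_sum_of_subset_of_nonneg hN fun i _ _ => hpos i).trans ?_
    rw [Finset.sum_range_sub']
    exact sub_le_self _ (hA0 _ (haA N))
  have h := hnull.norm
  rw [norm_zero] at h
  obtain ⟨n, hn⟩ := (h.eventually_lt_const hε).exists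
  refine hn.not_ge ?_
  rw [hsucc]
  exact hgε _ (haA n)

theorem OrderBoundedDisjointSeqNull.hasOrderContinuousNorm [CompleteSpace E]
    (hE : OrderBoundedDisjointSeqNull E) : HasOrderContinuousNorm E := by
  intro A hne hdir hglb
  have hA0 : ∀ a ∈ A, 0 ≤ a := fun a ha => hglb.1 ha
  have hstep : ∀ (n : ℕ) (c : E), c ∈ A →
      ∃ a ∈ A, a ≤ c ∧ ∀ b ∈ A, b ≤ a → ‖a - b‖ < (1 / 2) ^ n := by
    intro n c hcA
    obtain ⟨a, ⟨haA, hac⟩, ha⟩ := hE.exists_norm_sub_lt (A := {a | a ∈ A ∧ a ≤ c})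
      ⟨c, hcA, le_rfl⟩ (fun a ha => hA0 a ha.1) (ε := (1 / 2) ^ n) (by positivity)
    exact ⟨a, haA, hac, fun b hb hba => ha b ⟨hb, hba.trans hac⟩ hba⟩
  choose! g hgA hgle hg using hstep
  obtain ⟨a₀, ha₀⟩ := hne
  let a : ℕ → E := fun n => Nat.rec (g 0 a₀) (fun n c => g (n + 1) c) n
  have haA : ∀ n, a n ∈ A := by
    intro n
    induction n with
    | zero => exact hgA 0 _ ha₀
    | succ n ih => exact hgA (n + 1) _ ih
  have ha : ∀ n, ∀ b ∈ A, b ≤ a n → ‖a n - b‖ < (1 / 2) ^ n := by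
    intro n
    cases n with
    | zero => exact hg 0 _ ha₀
    | succ n => exact hg (n + 1) _ (haA n)
  have hanti : Antitone a := antitone_nat_of_succ_le fun n => hgle (n + 1) _ (haA n)
  have hcau : CauchySeq a := by
    refine cauchySeq_of_le_geometric (1 / 2) 1 (by norm_num) fun n => ?_
    rw [dist_eq_norm, one_mul]
    exact (ha n _ (haA (n + 1)) (hanti n.le_succ)).le
  obtain ⟨l, hl⟩ := cauchySeq_tendsto_of_complete hcau
  have hl0 : l = 0 := by
    refine le_antisymm (hglb.2 fun b hb => ?_) (ge_of_tendsto' hl fun n => hA0 _ (haA n))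
    -- Near-minimality of `a n` forces the common lower bounds `c n` to the same limit, so `l ≤ b`.
    choose c hcA hca hcb using fun n => hdir (a n) (haA n) b hb
    have hc : Tendsto c atTop (𝓝 l) := by
      have h1 : Tendsto (fun n => a n - c n) atTop (𝓝 0) :=
        squeeze_zero_norm (fun n => (ha n (c n) (hcA n) (hca n)).le)
          (tendsto_pow_atTop_nhds_zero_of_lt_one (by norm_num) (by norm_num))
      simpa using hl.sub h1
    exact le_of_tendsto' hc hcb
  rw [hl0] at hl
  refine ⟨?_, fun r hr => ?_⟩
  · rintro _ ⟨x, _, rfl⟩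
    exact norm_nonneg x
  · have h := hl.norm
    rw [norm_zero] at h
    exact ge_of_tendsto' h fun n => hr ⟨a n, haA n, rfl⟩

end OrderContinuity

/-! ### Weak summability and limited sets. -/

section DisjointSequences

variable {E : Type*} [NormedAddCommGroup E] [NormedSpace ℝ E]

theorem isWeaklyPSummable_of_summable {p : ℝ} (hp : 1 ≤ p) {x : ℕ → E}
    (hx : ∀ f : StrongDual ℝ E, Summable fun n => |f (x n)|) : IsWeaklyPSummable p x := by
  intro f
  refine Summable.of_norm_bounded_eventually_nat (hx f) ?_
  filter_upwards [(hx f).tendsto_atTop_zero.eventually_le_const one_pos] with n hn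
  rw [Real.norm_of_nonneg (by positivity)]
  exact (Real.rpow_le_rpow_of_exponent_ge' (abs_nonneg _) hn zero_le_one hp).trans_eq
    (Real.rpow_one _)

theorem isLimitedSet_range_of_tendsto_zero [CompleteSpace E] {x : ℕ → E}
    (hx : Tendsto x atTop (𝓝 0)) : IsLimitedSet (Set.range x) := by
  intro f hf
  have hpt : ∀ y, Tendsto (fun n => f n y) atTop (𝓝 0) :=
    tendsto_iff_forall_eval_tendsto_topDualPairing.1 hf
  obtain ⟨C, hC⟩ := banach_steinhaus (g := fun n => WeakDual.toStrongDual (f n)) fun y => by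
    obtain ⟨C, hC⟩ := (hpt y).norm.bddAbove_range
    exact ⟨C, fun n => hC ⟨n, rfl⟩⟩
  have hC0 : 0 ≤ C := (norm_nonneg _).trans (hC 0)
  rw [Metric.tendstoUniformlyOn_iff]
  intro ε hε
  have hx' := hx.norm
  rw [norm_zero] at hx'
  obtain ⟨N, hN⟩ := eventually_atTop.1
    (hx'.eventually_lt_const (show 0 < ε / (C + 1) by positivity))
  have hfin : ∀ᶠ n in atTop, ∀ k ∈ Finset.range N, |f n (x k)| < ε := by
    rw [Filter.eventually_all_finset]
    intro k _
    have := (hpt (x k)).norm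
    rw [norm_zero] at this
    exact this.eventually_lt_const hε
  filter_upwards [hfin] with n hn
  rintro _ ⟨k, rfl⟩
  rw [dist_zero_left, Real.norm_eq_abs]
  rcases lt_or_ge k N with hk | hk
  · exact hn k (Finset.mem_range.2 hk)
  · calc |f n (x k)| ≤ ‖WeakDual.toStrongDual (f n)‖ * ‖x k‖ :=
        (WeakDual.toStrongDual (f n)).le_opNorm (x k)
      _ ≤ (C + 1) * ‖x k‖ := by gcongr; exact (hC n).trans (by linarith)
      _ < (C + 1) * (ε / (C + 1)) := by gcongr; exact hN k hk
      _ = ε := by field_simp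

variable [Lattice E] [IsOrderedAddMonoid E] [HasSolidNorm E]

/-- Absorbing signs, a partial sum is `f` of a signed sum of the `w n`, whose modulus is at most `x`
by disjointness. -/
theorem summable_abs_apply_of_pairwise_inf_eq_zero {w : ℕ → E} {x : E} (hw : ∀ n, 0 ≤ w n)
    (hwx : ∀ n, w n ≤ x) (hd : Pairwise fun m n => w m ⊓ w n = 0) (f : StrongDual ℝ E) :
    Summable fun n => |f (w n)| := by
  refine summable_of_sum_le (c := ‖f‖ * ‖x‖) (fun _ => abs_nonneg _) fun s => ?_
  have habs : ∀ n, |f (w n)| = f (if 0 ≤ f (w n) then w n else -w n) := by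
    intro n
    split_ifs with h
    · exact abs_of_nonneg h
    · rw [map_neg, abs_of_neg (not_le.1 h)]
  simp_rw [habs]
  rw [← map_sum]
  refine (le_abs_self _).trans ((f.le_opNorm _).trans ?_)
  gcongr
  have hsum := sum_le_of_pairwise_inf_eq_zero hw hd ((hw 0).trans (hwx 0)) hwx s
  refine norm_le_norm_of_abs_le_abs ?_
  rw [abs_of_nonneg ((hw 0).trans (hwx 0))]
  refine abs_le'.2 ⟨le_trans (Finset.sum_le_sum fun n _ => ?_) hsum, ?_⟩
  · split_ifs
    · exact le_rfl
    · exact neg_le_self (hw n)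
  · rw [← Finset.sum_neg_distrib]
    refine le_trans (Finset.sum_le_sum fun n _ => ?_) hsum
    split_ifs
    · exact neg_le_self (hw n)
    · rw [neg_neg]

theorem HasPositiveSchurProperty.orderBoundedDisjointSeqNull {p : ℝ} (hp : 1 ≤ p)
    (hE : HasPositiveSchurProperty p E) : OrderBoundedDisjointSeqNull E := fun w _ hw hwx hd =>
  hE w (fun m n hmn => by simpa only [abs_of_nonneg (hw _)] using hd hmn)
    (isWeaklyPSummable_of_summable hp (summable_abs_apply_of_pairwise_inf_eq_zero hw hwx hd))

end DisjointSequences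

/-! ### Norming functionals localized on bands. -/

section LocalizedFunctional

variable {E : Type*} [NormedAddCommGroup E] [NormedSpace ℝ E] [Lattice E]

/-- The norm of the component of `y` in the band generated by `u ≥ 0`, as the supremum
of `‖|y| ⊓ k • u‖` over `k ≥ 0`. -/
noncomputable def bandNorm (u y : E) : ℝ := ⨆ k : NNReal, ‖|y| ⊓ (k : ℝ) • u‖

theorem bandNorm_nonneg (u y : E) : 0 ≤ bandNorm u y := Real.iSup_nonneg fun _ => norm_nonneg _

theorem bandNorm_neg (u y : E) : bandNorm u (-y) = bandNorm u y := by
  simp only [bandNorm, abs_neg]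

variable [IsOrderedAddMonoid E] [IsOrderedModule ℝ E]

/-- Almost attaining each supremum gives elements `|y| ⊓ k n • |x n|`, disjoint and bounded by
`|y|`. -/
theorem OrderBoundedDisjointSeqNull.tendsto_bandNorm (hE : OrderBoundedDisjointSeqNull E)
    {x : ℕ → E} (hx : IsDisjointSeq x) (y : E) :
    Tendsto (fun n => bandNorm |x n| y) atTop (𝓝 0) := by
  have hk : ∀ n : ℕ, ∃ k : NNReal, bandNorm |x n| y < ‖|y| ⊓ (k : ℝ) • |x n|‖ + 1 / (n + 1) := by
    intro n
    have hn : (0 : ℝ) < 1 / (n + 1) := by positivity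
    obtain ⟨k, hk⟩ := exists_lt_of_lt_ciSup
      (show bandNorm |x n| y - 1 / (n + 1) < ⨆ k : NNReal, ‖|y| ⊓ (k : ℝ) • |x n|‖ from
        sub_lt_self _ hn)
    exact ⟨k, sub_lt_iff_lt_add.1 hk⟩
  choose k hk using hk
  have hpos : ∀ n, 0 ≤ (k n : ℝ) • |x n| := fun n => smul_nonneg (k n).2 (abs_nonneg _)
  have hw : Tendsto (fun n => |y| ⊓ (k n : ℝ) • |x n|) atTop (𝓝 0) := by
    refine hE _ |y| (fun n => le_inf (abs_nonneg y) (hpos n)) (fun n => inf_le_left) ?_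
    intro m n hmn
    set c : ℝ := max 1 (max (k m) (k n)) with hc
    have hc0 : 0 ≤ c := zero_le_one.trans (le_max_left _ _)
    refine inf_eq_zero_of_le (le_inf (abs_nonneg y) (hpos m)) (le_inf (abs_nonneg y) (hpos n))
      (a := c • |x m|) (b := c • |x n|) (inf_le_right.trans ?_) (inf_le_right.trans ?_) ?_
    · exact smul_le_smul_of_nonneg_right ((le_max_left _ _).trans (le_max_right _ _))
        (abs_nonneg _)
    · exact smul_le_smul_of_nonneg_right ((le_max_right _ _).trans (le_max_right _ _))
        (abs_nonneg _)
    · rw [← smul_inf_of_nonneg hc0, hx hmn, smul_zero]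
  have h := hw.norm.add tendsto_one_div_add_atTop_nhds_zero_nat
  rw [norm_zero, add_zero] at h
  exact squeeze_zero (fun n => bandNorm_nonneg _ y) (fun n => (hk n).le) h

variable [HasSolidNorm E]

theorem norm_inf_smul_le_bandNorm {u : E} (hu : 0 ≤ u) (y : E) (k : NNReal) :
    ‖|y| ⊓ (k : ℝ) • u‖ ≤ bandNorm u y :=
  le_ciSup (f := fun k : NNReal => ‖|y| ⊓ (k : ℝ) • u‖) ⟨‖y‖, by
    rintro _ ⟨k, rfl⟩
    exact norm_inf_le_norm_of_nonneg (smul_nonneg k.2 hu) y⟩ k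

theorem bandNorm_le_norm {u : E} (hu : 0 ≤ u) (y : E) : bandNorm u y ≤ ‖y‖ :=
  ciSup_le fun k => norm_inf_le_norm_of_nonneg (smul_nonneg k.2 hu) y

theorem bandNorm_abs_self (x : E) : bandNorm |x| x = ‖x‖ := by
  refine le_antisymm (bandNorm_le_norm (abs_nonneg x) x) ?_
  simpa [norm_abs_eq_norm] using norm_inf_smul_le_bandNorm (abs_nonneg x) x 1

theorem bandNorm_add_le {u : E} (hu : 0 ≤ u) (y z : E) :
    bandNorm u (y + z) ≤ bandNorm u y + bandNorm u z := by
  refine ciSup_le fun k => ?_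
  have hk : 0 ≤ (k : ℝ) • u := smul_nonneg k.2 hu
  refine le_trans (norm_le_norm_of_nonneg_of_le (le_inf (abs_nonneg _) hk) ?_)
    ((norm_add_le (|y| ⊓ (k : ℝ) • u) (|z| ⊓ (k : ℝ) • u)).trans
      (add_le_add (norm_inf_smul_le_bandNorm hu y k) (norm_inf_smul_le_bandNorm hu z k)))
  calc |y + z| ⊓ (k : ℝ) • u ≤ (k : ℝ) • u ⊓ (|y| + |z|) := by
        rw [inf_comm]; exact inf_le_inf_left _ (abs_add_le y z)
    _ ≤ (k : ℝ) • u ⊓ |y| + (k : ℝ) • u ⊓ |z| :=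
        inf_add_le_inf_add_inf hk (abs_nonneg y) (abs_nonneg z)
    _ = _ := by rw [inf_comm, inf_comm |z|]

/-- The supremum over all `k` pays off here: scaling by `c` only reparametrizes `k`, which makes
`bandNorm` sublinear and fit for Hahn-Banach. -/
theorem bandNorm_smul_le {u : E} (hu : 0 ≤ u) {c : ℝ} (hc : 0 < c) (y : E) :
    bandNorm u (c • y) ≤ c * bandNorm u y := by
  refine ciSup_le fun k => ?_
  have h : |c • y| ⊓ (k : ℝ) • u = c • (|y| ⊓ ((k / c.toNNReal : NNReal) : ℝ) • u) := by
    rw [smul_inf_of_nonneg hc.le, abs_smul_of_nonneg hc.le, smul_smul]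
    rw [NNReal.coe_div, Real.coe_toNNReal c hc.le, mul_div_cancel₀ _ hc.ne']
  rw [h, norm_smul, Real.norm_of_nonneg hc.le]
  gcongr
  exact norm_inf_smul_le_bandNorm hu y _

theorem bandNorm_smul {u : E} (hu : 0 ≤ u) {c : ℝ} (hc : 0 < c) (y : E) :
    bandNorm u (c • y) = c * bandNorm u y := by
  refine le_antisymm (bandNorm_smul_le hu hc y) ?_
  have h := bandNorm_smul_le hu (inv_pos.2 hc) (c • y)
  rwa [smul_smul, inv_mul_cancel₀ hc.ne', one_smul, le_inv_mul_iff₀ hc] at h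

/-- Every element is normed by a functional dominated by the band seminorm of its modulus. -/
theorem exists_strongDual_abs_le_bandNorm (x : E) :
    ∃ f : StrongDual ℝ E, f x = ‖x‖ ∧ ∀ y, |f y| ≤ bandNorm |x| y := by
  rcases eq_or_ne x 0 with rfl | hx
  · exact ⟨0, by simp, fun y => by simpa using bandNorm_nonneg _ y⟩
  have hu := abs_nonneg x
  obtain ⟨g, hgx, hg⟩ := exists_extension_of_le_sublinear
    (LinearPMap.mkSpanSingleton (K := ℝ) (L := ℝ) (σ := RingHom.id ℝ) x ‖x‖ hx) (bandNorm |x|)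
    (fun c hc y => bandNorm_smul hu hc y) (bandNorm_add_le hu) (by
      rintro ⟨y, hy⟩
      obtain ⟨t, rfl⟩ := Submodule.mem_span_singleton.1 hy
      refine (LinearPMap.mkSpanSingleton'_apply x ‖x‖ _ t hy).trans_le ?_
      change t * ‖x‖ ≤ bandNorm |x| (t • x)
      rcases le_or_gt t 0 with ht | ht
      · exact (mul_nonpos_of_nonpos_of_nonneg ht (norm_nonneg x)).trans (bandNorm_nonneg _ _)
      · rw [bandNorm_smul hu ht, bandNorm_abs_self])
  have habs : ∀ y, |g y| ≤ bandNorm |x| y := fun y =>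
    abs_le'.2 ⟨hg y, by rw [← map_neg, ← bandNorm_neg]; exact hg (-y)⟩
  refine ⟨g.mkContinuous 1 fun y => ?_, ?_, habs⟩
  · rw [one_mul]
    exact (habs y).trans (bandNorm_le_norm hu y)
  · exact (hgx ⟨x, Submodule.mem_span_singleton_self x⟩).trans
      (LinearPMap.mkSpanSingleton_apply ℝ ℝ hx ‖x‖)

theorem IsDisjointSeq.tendsto_zero_of_isLimitedSet_range (hE : OrderBoundedDisjointSeqNull E)
    {x : ℕ → E} (hx : IsDisjointSeq x) (hlim : IsLimitedSet (Set.range x)) :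
    Tendsto x atTop (𝓝 0) := by
  choose f hfx hf using fun n => exists_strongDual_abs_le_bandNorm (x n)
  have hnull : Tendsto (fun n => StrongDual.toWeakDual (f n)) atTop (𝓝 0) :=
    tendsto_iff_forall_eval_tendsto_topDualPairing.2 fun y =>
      squeeze_zero_norm (fun n => hf n y) (hE.tendsto_bandNorm hx y)
  rw [tendsto_zero_iff_norm_tendsto_zero, Metric.tendsto_nhds]
  intro ε hε
  filter_upwards [Metric.tendstoUniformlyOn_iff.1 (hlim _ hnull) ε hε] with n hn
  have h := hn (x n) ⟨n, rfl⟩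
  rwa [dist_comm, StrongDual.toWeakDual_apply, hfx] at h

end LocalizedFunctional

theorem proposition3p6 {E : Type*} [NormedAddCommGroup E] [NormedSpace ℝ E] [CompleteSpace E]
    [Lattice E] [IsOrderedAddMonoid E] [IsOrderedModule ℝ E] [HasSolidNorm E]
    (p : ℝ) (hp : 1 ≤ p) :
    HasPositiveSchurProperty p E ↔
      HasOrderContinuousNorm E ∧ HasDisjointDPStarProperty p E :=
  ⟨fun h => ⟨(h.orderBoundedDisjointSeqNull hp).hasOrderContinuousNorm,
      fun x hx hxp => isLimitedSet_range_of_tendsto_zero (h x hx hxp)⟩,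
    fun h x hx hxp =>
      hx.tendsto_zero_of_isLimitedSet_range h.1.orderBoundedDisjointSeqNull (h.2 x hx hxp)⟩
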